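/- Let $n$ and $t$ be positive integers and put $N=nt$. Let $\Sigma(n,t)$ be the set of $n\times n$ matrices with non-negative integer entries all of whose row sums and column sums equal $t$. Let $$\Delta=\Bigl\{X=(x_{ij})\in\mathbb R^{n\times n}:\ x_{ij}>0 \text{ for all } i,j,\ \sum_{i,j=1}^n x_{ij}=1\Bigr\}.$$ Let $J_t$ be the $t\times t$ matrix all of whose entries are $1/t$, and for an $n\times n$ matrix $A=(a_{ij})$ let $A\otimes J_t$ be the $N\times N$ block matrix whose $(i,j)$-th block is the $t\times t$ matrix with all entries $a_{ij}/t$. For $X\in\Delta$ let $Y$ be the doubly stochastic scaling of $X$, that is, the unique positive $n\times n$ doubly stochastic matrix $Y=(y_{ij})$ such that $x_{ij}=y_{ij}\lambda_i\mu_j$ for all $i,j$ and some positive numbers $\lambda_1,\dots,\lambda_n,\mu_1,\dots,\mu_n$. Writing $\operatorname{per}$ for the permanent, define $$p(X)=\frac{N^N}{N!}\operatorname{per}(Y\otimes J_t),\qquad f(X)=\frac{(N+n^2-1)!\,t^N}{(n^2-1)!\,(t!)^{2n}}\operatorname{per}(X\otimes J_t)\qquad\text{for } X\in\Delta.$$ Then: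 1. $\displaystyle \binom{N+n^2-1}{n^2-1}\ \ge\ |\Sigma(n,t)|\ \ge\ (N+n)^{-2n}\binom{N+n^2-1}{n^2-1}$; 2. $1\le p(X)\le (8t)^{n/2}$ for all $X\in\Delta$; 3. $\displaystyle 0\le f(X)\le \binom{N+n^2-1}{n^2-1}$ for all $X\in\Delta$. -/

import Mathlib

open scoped Nat Kronecker

namespace MagicSquares

/-- The set `Σ(n, t)` of `n × n` magic squares with line sum `t`: nonnegative integer matrices all
of whose row sums and column sums equal `t`. -/
def magicSquares (n t : ℕ) : Set (Matrix (Fin n) (Fin n) ℕ) :=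
  {D | (∀ i, ∑ j, D i j = t) ∧ ∀ j, ∑ i, D i j = t}

/-- The open simplex `Δ` of positive `n × n` real matrices whose entries sum to `1`. -/
def simplex (n : ℕ) : Set (Matrix (Fin n) (Fin n) ℝ) :=
  {X | (∀ i j, 0 < X i j) ∧ ∑ i, ∑ j, X i j = 1}

/-- `J t` is the `t × t` matrix all of whose entries are `1 / t`. -/
noncomputable def J (t : ℕ) : Matrix (Fin t) (Fin t) ℝ :=
  Matrix.of fun _ _ => 1 / (t : ℝ)

/-- `Y` is a doubly stochastic scaling of `X`: it is positive and doubly stochastic, and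
`x i j = y i j * l i * m j` for some positive numbers `l i`, `m j`. -/
structure IsScaling {n : ℕ} (X Y : Matrix (Fin n) (Fin n) ℝ) : Prop where
  pos : ∀ i j, 0 < Y i j
  doublyStochastic : Y ∈ doublyStochastic ℝ (Fin n)
  scaling : ∃ l m : Fin n → ℝ, (∀ i, 0 < l i) ∧ (∀ j, 0 < m j) ∧
    ∀ i j, X i j = Y i j * l i * m j

/-- Every positive matrix has a doubly stochastic scaling. -/
theorem exists_isScaling {n : ℕ} (X : Matrix (Fin n) (Fin n) ℝ) (hX : ∀ i j, 0 < X i j) :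
    ∃ Y, IsScaling X Y := by
  rcases Nat.eq_zero_or_pos n with rfl | hn
  · exact ⟨1, fun i => i.elim0, one_mem _, fun _ => 1, fun _ => 1, fun i => i.elim0,
      fun i => i.elim0, fun i => i.elim0⟩
  have : Nonempty (Fin n) := ⟨⟨0, hn⟩⟩
  let L : (Fin n → ℝ) → Fin n → ℝ := fun v i => ∑ j, X i j * v j
  have hLpos : ∀ v : Fin n → ℝ, (∀ j, 0 < v j) → ∀ i, 0 < L v i := fun v hv i =>
    Finset.sum_pos (fun j _ => mul_pos (hX i j) (hv j)) Finset.univ_nonempty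
  let h : (Fin n → ℝ) → ℝ := fun v => (∏ j, v j) / ∏ i, L v i
  have hLs : ∀ v ∈ stdSimplex ℝ (Fin n), ∀ i, 0 < L v i := by
    intro v hv i
    obtain ⟨j, -, hj⟩ : ∃ j ∈ Finset.univ, 0 < v j := by
      apply Finset.exists_lt_of_sum_lt (f := fun _ => (0 : ℝ))
      simp [hv.2]
    exact Finset.sum_pos' (fun j _ => mul_nonneg (hX i j).le (hv.1 j))
      ⟨j, Finset.mem_univ _, mul_pos (hX i j) hj⟩
  have hcont : ContinuousOn h (stdSimplex ℝ (Fin n)) := by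
    apply ContinuousOn.div
    · fun_prop
    · fun_prop
    · intro v hv
      exact (Finset.prod_pos fun i _ => hLs v hv i).ne'
  have hmem : ∀ v : Fin n → ℝ, (∀ j, 0 < v j) →
      (fun j => v j / ∑ k, v k) ∈ stdSimplex ℝ (Fin n) := by
    intro v hv
    have hs : 0 < ∑ k, v k := Finset.sum_pos (fun j _ => hv j) Finset.univ_nonempty
    refine ⟨fun j => (div_pos (hv j) hs).le, ?_⟩
    rw [← Finset.sum_div, div_self hs.ne']
  have hhom : ∀ v : Fin n → ℝ, (∀ j, 0 < v j) → h (fun j => v j / ∑ k, v k) = h v := by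
    intro v hv
    have hs : 0 < ∑ k, v k := Finset.sum_pos (fun j _ => hv j) Finset.univ_nonempty
    have h1 : ∀ i, L (fun j => v j / ∑ k, v k) i = L v i / ∑ k, v k := by
      intro i
      simp only [L, Finset.sum_div, mul_div_assoc]
    have h2 : (∏ i, L v i) ≠ 0 := (Finset.prod_pos fun i _ => hLpos v hv i).ne'
    simp only [h, h1, Finset.prod_div_distrib, Finset.prod_const]
    rw [div_div_div_cancel_right₀ (pow_ne_zero _ hs.ne')]
  obtain ⟨w, hw, hmax⟩ := (isCompact_stdSimplex ℝ (Fin n)).exists_isMaxOn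
    ⟨_, hmem (fun _ => 1) (fun _ => one_pos)⟩ hcont
  have hle : ∀ v : Fin n → ℝ, (∀ j, 0 < v j) → h v ≤ h w := fun v hv =>
    hhom v hv ▸ hmax (hmem v hv)
  have hpos : ∀ v : Fin n → ℝ, (∀ j, 0 < v j) → 0 < h v := fun v hv =>
    div_pos (Finset.prod_pos fun j _ => hv j) (Finset.prod_pos fun i _ => hLpos v hv i)
  have hwpos : ∀ j, 0 < w j := by
    intro j
    refine lt_of_le_of_ne (hw.1 j) fun h0 => ?_
    have := (hpos (fun _ => 1) fun _ => one_pos).trans_le (hle _ fun _ => one_pos)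
    have h1 : h w = 0 := by
      simp only [h, Finset.prod_eq_zero (Finset.mem_univ j) h0.symm, zero_div]
    exact this.ne' h1
  let G : (Fin n → ℝ) → ℝ := fun v => ∑ j, Real.log (v j) - ∑ i, Real.log (L v i)
  have hG : ∀ v : Fin n → ℝ, (∀ j, 0 < v j) → G v = Real.log (h v) := by
    intro v hv
    simp only [G, h]
    rw [Real.log_div (Finset.prod_pos fun j _ => hv j).ne'
      (Finset.prod_pos fun i _ => hLpos v hv i).ne',
      Real.log_prod fun j _ => (hv j).ne', Real.log_prod fun i _ => (hLpos v hv i).ne']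
  have hcrit : ∀ k, ∑ i, X i k / L w i = 1 / w k := by
    intro k
    let c : ℝ → Fin n → ℝ := fun s j => w j + s * (Pi.single k (1 : ℝ) : Fin n → ℝ) j
    have hc0 : c 0 = w := by funext j; simp [c]
    have hev : ∀ᶠ s in nhds (0 : ℝ), ∀ j, 0 < c s j := by
      rw [Filter.eventually_all]
      intro j
      have hcj : Continuous fun s => c s j := by fun_prop
      exact hcj.continuousAt.eventually (lt_mem_nhds (by simpa [c] using hwpos j))
    have hloc : IsLocalMax (fun s => G (c s)) 0 := by
      filter_upwards [hev] with s hs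
      rw [hc0, hG _ hs, hG _ hwpos]
      exact Real.log_le_log (hpos _ hs) (hle _ hs)
    have hcd : ∀ j, HasDerivAt (fun s => c s j) ((Pi.single k (1 : ℝ) : Fin n → ℝ) j) 0 := by
      intro j
      have h1 := ((hasDerivAt_id' (0 : ℝ)).mul_const
        ((Pi.single k (1 : ℝ) : Fin n → ℝ) j)).const_add (w j)
      rw [one_mul] at h1
      exact h1
    have hLd : ∀ i, HasDerivAt (fun s => L (c s) i)
        (∑ j, X i j * (Pi.single k (1 : ℝ) : Fin n → ℝ) j) 0 := fun i =>
      HasDerivAt.fun_sum fun j _ => (hcd j).const_mul (X i j)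
    have hd : HasDerivAt (fun s => G (c s))
        (∑ j, (Pi.single k (1 : ℝ) : Fin n → ℝ) j / c 0 j -
          ∑ i, (∑ j, X i j * (Pi.single k (1 : ℝ) : Fin n → ℝ) j) / L (c 0) i) 0 := by
      refine (HasDerivAt.fun_sum fun j _ => (hcd j).log ?_).fun_sub
        (HasDerivAt.fun_sum fun i _ => (hLd i).log ?_)
      · rw [hc0]; exact (hwpos j).ne'
      · rw [hc0]; exact (hLpos w hwpos i).ne'
    have h0 := hloc.hasDerivAt_eq_zero hd
    rw [hc0] at h0
    simp [Pi.single_apply, ite_div] at h0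
    rw [one_div]
    linarith
  refine ⟨Matrix.of fun i j => X i j * w j / L w i, ?_, ?_, L w, fun j => (w j)⁻¹,
    hLpos w hwpos, fun j => inv_pos.2 (hwpos j), ?_⟩
  · intro i j
    exact div_pos (mul_pos (hX i j) (hwpos j)) (hLpos w hwpos i)
  · rw [mem_doublyStochastic_iff_sum]
    refine ⟨fun i j => (div_pos (mul_pos (hX i j) (hwpos j)) (hLpos w hwpos i)).le, ?_, ?_⟩
    · intro i
      simp only [Matrix.of_apply]
      rw [← Finset.sum_div]
      exact div_self (hLpos w hwpos i).ne'
    · intro j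
      have h1 : ∀ i, X i j * w j / L w i = w j * (X i j / L w i) := fun i => by ring
      simp only [Matrix.of_apply, h1]
      rw [← Finset.mul_sum, hcrit, mul_one_div_cancel (hwpos j).ne']
  · intro i j
    have h1 := (hwpos j).ne'
    have h2 := (hLpos w hwpos i).ne'
    simp only [Matrix.of_apply]
    field_simp

/-- The doubly stochastic scaling of a matrix is unique. -/
theorem IsScaling.unique {n : ℕ} {X Y Z : Matrix (Fin n) (Fin n) ℝ}
    (hY : IsScaling X Y) (hZ : IsScaling X Z) : Y = Z := by
  obtain ⟨l, m, hl, hm, hXY⟩ := hY.scaling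
  obtain ⟨l', m', hl', hm', hXZ⟩ := hZ.scaling
  obtain ⟨-, hYr, hYc⟩ := mem_doublyStochastic_iff_sum.1 hY.doublyStochastic
  obtain ⟨-, hZr, hZc⟩ := mem_doublyStochastic_iff_sum.1 hZ.doublyStochastic
  let a : Fin n → ℝ := fun i => l i / l' i
  let b : Fin n → ℝ := fun j => m j / m' j
  have ha : ∀ i, 0 < a i := fun i => div_pos (hl i) (hl' i)
  have hb : ∀ j, 0 < b j := fun j => div_pos (hm j) (hm' j)
  have hZY : ∀ i j, Z i j = Y i j * a i * b j := by
    intro i j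
    have h1 := (hl' i).ne'
    have h2 := (hm' j).ne'
    have h3 : Z i j * l' i * m' j = Y i j * l i * m j := (hXZ i j).symm.trans (hXY i j)
    simp only [a, b]
    field_simp
    linarith
  ext i₁ j₁
  have : Nonempty (Fin n) := ⟨i₁⟩
  obtain ⟨i₀, hi₀⟩ := Finite.exists_max a
  have hbge : ∀ j, 1 ≤ a i₀ * b j := by
    intro j
    rw [← hZc j, ← one_mul (a i₀ * b j), ← hYc j, Finset.sum_mul]
    refine Finset.sum_le_sum fun i _ => ?_
    rw [hZY, mul_assoc]
    exact mul_le_mul_of_nonneg_left (mul_le_mul_of_nonneg_right (hi₀ i) (hb j).le)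
      (hY.pos i j).le
  have hbeq : ∀ j, a i₀ * b j = 1 := by
    have h1 : ∑ j, Y i₀ j = ∑ j, Y i₀ j * (a i₀ * b j) := by
      rw [hYr, ← hZr i₀]
      exact Finset.sum_congr rfl fun j _ => by rw [hZY, mul_assoc]
    have h2 := (Finset.sum_eq_sum_iff_of_le fun j _ =>
      le_mul_of_one_le_right (hY.pos i₀ j).le (hbge j)).1 h1
    intro j
    have h3 := h2 j (Finset.mem_univ j)
    have h4 := (hY.pos i₀ j).ne'
    have h5 : Y i₀ j * (a i₀ * b j) = Y i₀ j * 1 := by linarith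
    exact mul_left_cancel₀ h4 h5
  have hbc : ∀ j, b j = (a i₀)⁻¹ := fun j => eq_inv_of_mul_eq_one_right (hbeq j)
  have haeq : a i₁ * (a i₀)⁻¹ = 1 := by
    have h1 := hZr i₁
    simp only [hZY, hbc, mul_assoc] at h1
    rwa [← Finset.sum_mul, hYr, one_mul] at h1
  rw [hZY, hbc, mul_assoc, haeq, mul_one]

/-- The doubly stochastic scaling `Y` of a positive matrix `X`. -/
noncomputable def scaling {n : ℕ} (X : Matrix (Fin n) (Fin n) ℝ) (hX : ∀ i j, 0 < X i j) :
    Matrix (Fin n) (Fin n) ℝ :=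
  (exists_isScaling X hX).choose

/-- The function `p(X) = (N ^ N / N!) per (Y ⊗ J_t)` on the simplex, where `N = n t` and `Y` is the
doubly stochastic scaling of `X`. -/
noncomputable def p {n : ℕ} (t : ℕ) (X : simplex n) : ℝ :=
  ((n * t : ℕ) : ℝ) ^ (n * t) / ((n * t)! : ℝ) * (scaling X.1 X.2.1 ⊗ₖ J t).permanent

/-- The density
`f(X) = ((N + n ^ 2 - 1)! t ^ N / ((n ^ 2 - 1)! (t!) ^ (2 n))) per (X ⊗ J_t)` on the simplex, where
`N = n t`. -/
noncomputable def f {n : ℕ} (t : ℕ) (X : simplex n) : ℝ :=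
  ((n * t + n ^ 2 - 1)! : ℝ) * (t : ℝ) ^ (n * t) / (((n ^ 2 - 1)! : ℝ) * (t ! : ℝ) ^ (2 * n)) *
    (X.1 ⊗ₖ J t).permanent

end MagicSquares

/-! Counting. Magic squares are among the non-negative integer matrices with total `N = nt`, which
gives the upper bound. For the lower bound, sort those matrices by their margins: there are at most
`(N + 1) ^ (2n)` margins, and no margin carries more tables than the constant one. Indeed, moving a
unit from a larger row sum to a smaller one cannot lose tables (`card_tables_le_transfer`), because
the number of ways to split the merged row is symmetric and unimodal (`boxCount_symm_unimodal`).

Lower bound on `p`. This is van der Waerden's inequality for the positive doubly stochastic matrix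
`Y ⊗ J_t`, proved by Gurvits's method. The permanent is the iterated derivative of `∏ X i` in the
directions of the columns. Each derivative preserves stability, and a univariate inequality for
real-rooted polynomials bounds the loss of capacity. The losses telescope to `N! / N ^ N`.

Upper bounds on `p` and `f`. A term of `per (X ⊗ J_t)` depends only on the block map `k ↦ (σ k).1`,
and at most `(t!) ^ n` permutations share one. Summing over all maps turns the permanent into a
product of column sums or, when columns are freed as well, into a power of the total sum. For `p`,
`N ^ N / N! ≤ e ^ N` and a Stirling bound on `t!` finish. -/

theorem Multiset.map_sum_pos {A : Type*} [AddCommMonoid A] (g : A →+ ℝ) {s : Multiset A}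
    (hs : ∀ x ∈ s, 0 < g x) (h0 : s ≠ 0) : 0 < g s.sum := by
  induction s using Multiset.induction_on with
  | empty => exact absurd rfl h0
  | cons x s ih =>
    rw [Multiset.sum_cons, _root_.map_add]
    have hx := hs x (Multiset.mem_cons_self x s)
    rcases eq_or_ne s 0 with rfl | h
    · simpa using hx
    · exact add_pos hx (ih (fun y hy => hs y (Multiset.mem_cons_of_mem hy)) h)

/-! ### Restriction to lines, directional derivatives and stable polynomials. -/

namespace MvPolynomial

section Line

variable {σ K : Type*} [Field K]

/-- The restriction of `P` to the line `s ↦ u + s a`, as a univariate polynomial. -/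
noncomputable def line (P : MvPolynomial σ K) (u a : σ → K) : Polynomial K :=
  aeval (fun i => Polynomial.C (u i) + Polynomial.C (a i) * Polynomial.X) P

theorem eval_line (P : MvPolynomial σ K) (u a : σ → K) (s : K) :
    (P.line u a).eval s = eval (fun i => u i + a i * s) P := by
  have h : (Polynomial.evalRingHom s).comp
      (aeval (R := K) (fun i => Polynomial.C (u i) + Polynomial.C (a i) * Polynomial.X)).toRingHom =
      eval (fun i => u i + a i * s) := by
    ext <;> simp
  exact DFunLike.congr_fun h P

theorem map_line {L : Type*} [Field L] (g : K →+* L) (P : MvPolynomial σ K) (u a : σ → K) :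
    (P.line u a).map g = (P.map g).line (g ∘ u) (g ∘ a) := by
  have h : (Polynomial.mapRingHom g).comp
      (aeval (R := K) (fun i => Polynomial.C (u i) + Polynomial.C (a i) * Polynomial.X)).toRingHom =
      (aeval (R := L) (fun i => Polynomial.C (g (u i)) +
        Polynomial.C (g (a i)) * Polynomial.X)).toRingHom.comp (map g) := by
    ext <;> simp
  exact DFunLike.congr_fun h P

theorem natDegree_line_le {P : MvPolynomial σ K} {k : ℕ} (hP : P.IsHomogeneous k) (u a : σ → K) :
    (P.line u a).natDegree ≤ k := by
  have := aeval_natDegree_le P hP.totalDegree_le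
    (fun i => Polynomial.C (u i) + Polynomial.C (a i) * Polynomial.X) (n := 1) fun i => by
      compute_degree
  simpa [line] using this

/-- Only the `a i * X` parts of the linear factors reach degree `k`. This fixes the exact degree of
a restriction whenever `P` does not vanish at `a`. -/
theorem coeff_line {P : MvPolynomial σ K} {k : ℕ} (hP : P.IsHomogeneous k) (u a : σ → K) :
    (P.line u a).coeff k = eval a P := by
  rw [line, aeval_def, eval₂_eq, eval_eq, Polynomial.finsetSum_coeff]
  refine Finset.sum_congr rfl fun d hd => ?_
  have hk : k = ∑ i ∈ d.support, d i := by
    have := hP (mem_support_iff.1 hd)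
    rw [Finsupp.weight_apply] at this
    simp [Finsupp.sum] at this
    exact this.symm
  rw [Polynomial.algebraMap_eq, Polynomial.coeff_C_mul, hk]
  congr 1
  have key : ∀ s : Finset σ, (∏ i ∈ s, (Polynomial.C (u i) + Polynomial.C (a i) * Polynomial.X) ^ d i).natDegree ≤ ∑ i ∈ s, d i ∧ 
      (∏ i ∈ s, (Polynomial.C (u i) + Polynomial.C (a i) * Polynomial.X) ^ d i).coeff (∑ i ∈ s, d i)
        = ∏ i ∈ s, a i ^ d i := by
    classical
    intro s
    induction s using Finset.induction_on with
    | empty => simp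
    | insert j s hj ih =>
      have h1 : (Polynomial.C (u j) + Polynomial.C (a j) * Polynomial.X).natDegree ≤ 1 := by
        compute_degree
      have h2 : ((Polynomial.C (u j) + Polynomial.C (a j) * Polynomial.X) ^ d j).natDegree ≤ d j := by
        simpa using Polynomial.natDegree_pow_le_of_le (d j) h1
      rw [Finset.prod_insert hj, Finset.sum_insert hj, Finset.prod_insert hj]
      refine ⟨Polynomial.natDegree_mul_le_of_le h2 ih.1, ?_⟩
      rw [Polynomial.coeff_mul_add_eq_of_natDegree_le h2 ih.1, ih.2]
      have := Polynomial.coeff_pow_of_natDegree_le (m := d j) h1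
      rw [mul_one] at this
      rw [this]
      simp
  exact (key _).2

variable [Fintype σ]

/-- The derivative of a polynomial in the direction `a`. -/
noncomputable def dirDeriv (a : σ → K) : Module.End K (MvPolynomial σ K) :=
  ∑ i, a i • (pderiv i).toLinearMap

theorem dirDeriv_apply (a : σ → K) (P : MvPolynomial σ K) :
    dirDeriv a P = ∑ i, a i • pderiv i P := by
  simp [dirDeriv, LinearMap.sum_apply]

theorem derivative_line (P : MvPolynomial σ K) (u a : σ → K) :
    Polynomial.derivative (P.line u a) = (dirDeriv a P).line u a := by
  classical
  rw [dirDeriv_apply]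
  simp only [line]
  induction P using MvPolynomial.induction_on with
  | C c => simp
  | add p q hp hq => simp only [map_add, hp, hq, smul_add, Finset.sum_add_distrib]
  | mul_X p i hp =>
    rw [map_mul, Polynomial.derivative_mul, hp]
    simp only [Derivation.leibniz, pderiv_X, smul_add, Finset.sum_add_distrib, map_add, map_sum,
      smul_eq_mul, map_mul, map_smul, aeval_X, Pi.single_apply]
    simp [apply_ite, Finset.sum_mul, Polynomial.smul_eq_C_mul]
    rw [add_comm]
    congr 1
    · ring
    · exact Finset.sum_congr rfl fun x _ => by ring

theorem IsHomogeneous.dirDeriv {P : MvPolynomial σ K} {k : ℕ} (hP : P.IsHomogeneous k)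
    (a : σ → K) : (dirDeriv a P).IsHomogeneous (k - 1) := by
  rw [dirDeriv_apply]
  refine IsHomogeneous.sum _ _ _ fun i _ => ?_
  rw [smul_eq_C_mul]
  simpa using (isHomogeneous_C σ (a i)).mul (hP.pderiv (i := i))

theorem map_dirDeriv {L : Type*} [Field L] (g : K →+* L) (P : MvPolynomial σ K) (a : σ → K) :
    (dirDeriv a P).map g = dirDeriv (g ∘ a) (P.map g) := by
  simp [dirDeriv_apply, smul_eq_C_mul, pderiv_map]

end Line

theorem IsHomogeneous.eval_mul {σ K : Type*} [Field K] {P : MvPolynomial σ K} {k : ℕ}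
    (hP : P.IsHomogeneous k) (c : K) (z : σ → K) :
    eval (fun i => c * z i) P = c ^ k * eval z P := by
  rw [eval_eq, eval_eq, Finset.mul_sum]
  refine Finset.sum_congr rfl fun d hd => ?_
  have hk : k = ∑ i ∈ d.support, d i := by
    have := hP (mem_support_iff.1 hd)
    rw [Finsupp.weight_apply] at this
    simp [Finsupp.sum] at this
    exact this.symm
  simp only [mul_pow, Finset.prod_mul_distrib, Finset.prod_pow_eq_pow_sum, ← hk]
  ring

/-- A homogeneous real polynomial of degree `k` that is positive on the positive orthant and has no
zero all of whose coordinates have positive real part. -/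
structure IsHStable {σ : Type*} (P : MvPolynomial σ ℝ) (k : ℕ) : Prop where
  homogeneous : P.IsHomogeneous k
  eval_pos : ∀ x : σ → ℝ, (∀ i, 0 < x i) → 0 < eval x P
  eval_ne_zero : ∀ z : σ → ℂ, (∀ i, 0 < (z i).re) → eval z (P.map Complex.ofRealHom) ≠ 0

namespace IsHStable

variable {σ : Type*} {P : MvPolynomial σ ℝ} {k : ℕ}

theorem natDegree_line (hP : P.IsHStable k) (u : σ → ℝ) {a : σ → ℝ} (ha : ∀ i, 0 < a i) :
    (P.line u a).natDegree = k := by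
  refine (natDegree_line_le hP.homogeneous u a).antisymm (Polynomial.le_natDegree_of_ne_zero ?_)
  rw [coeff_line hP.homogeneous]
  exact (hP.eval_pos a ha).ne'

theorem eval_line_pos (hP : P.IsHStable k) {u a : σ → ℝ} (hu : ∀ i, 0 < u i)
    (ha : ∀ i, 0 < a i) {s : ℝ} (hs : 0 ≤ s) : 0 < (P.line u a).eval s := by
  rw [eval_line]
  exact hP.eval_pos _ fun i => by have := hu i; have := ha i; positivity

/-- Restrictions of stable polynomials to positive lines are real rooted. -/
theorem splits_line (hP : P.IsHStable k) {u a : σ → ℝ} (hu : ∀ i, 0 < u i)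
    (ha : ∀ i, 0 < a i) : (P.line u a).Splits := by
  refine Polynomial.Splits.of_splits_map Complex.ofRealHom (IsAlgClosed.splits _) fun z hz => ?_
  by_contra hreal
  replace hz := Polynomial.isRoot_of_mem_roots hz
  rw [Polynomial.IsRoot, map_line, eval_line] at hz
  have hslit : z ∈ Complex.slitPlane := by
    rw [Complex.mem_slitPlane_iff]
    right
    intro h0
    exact hreal ⟨z.re, Complex.ext (by simp) (by simp [h0])⟩
  have hz0 : z ≠ 0 := Complex.slitPlane_ne_zero hslit
  -- For a root `z` off the real axis, the principal square root `w` has positive real part.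
  -- Multiplying `u + a z` by `conj w` gives `u conj w + a |w|² w`, whose coordinates have positive
  -- real part; by homogeneity it is still a zero, against stability.
  set w := z ^ (1 / 2 : ℂ) with hw
  have hww : w * w = z := by
    rw [hw, ← Complex.cpow_add _ _ hz0]; norm_num
  have hwre : 0 < w.re := by
    have harg := Complex.mem_slitPlane_iff_arg.1 hslit
    rw [hw, Complex.cpow_def_of_ne_zero hz0, Complex.exp_re]
    refine mul_pos (Real.exp_pos _) (Real.cos_pos_of_mem_Ioo ?_)
    have h1 : (Complex.log z * (1 / 2)).im = z.arg / 2 := by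
      simp [Complex.mul_im, Complex.log_im]; ring
    rw [h1]
    have h2 := Complex.neg_pi_lt_arg z
    have h3 := (Complex.arg_le_pi z).lt_of_ne harg.1
    constructor <;> linarith
  have hc := hP.homogeneous.map Complex.ofRealHom |>.eval_mul ((starRingEnd ℂ) w)
    (fun i => (Complex.ofRealHom ∘ u) i + (Complex.ofRealHom ∘ a) i * z)
  rw [hz, mul_zero] at hc
  refine hP.eval_ne_zero _ (fun i => ?_) hc
  have h4 : (starRingEnd ℂ) w * ((Complex.ofRealHom ∘ u) i + (Complex.ofRealHom ∘ a) i * z) =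
      (u i : ℂ) * (starRingEnd ℂ) w + ((a i * Complex.normSq w : ℝ) : ℂ) * w := by
    rw [Complex.ofReal_mul, Complex.normSq_eq_conj_mul_self, ← hww]
    simp
    ring
  rw [h4, Complex.add_re, Complex.re_ofReal_mul, Complex.re_ofReal_mul, Complex.conj_re]
  have h5 : 0 < Complex.normSq w := Complex.normSq_pos.2 (by rintro h; simp [h] at hwre)
  have := hu i
  have := ha i
  positivity

theorem roots_line_neg (hP : P.IsHStable k) {u a : σ → ℝ} (hu : ∀ i, 0 < u i)
    (ha : ∀ i, 0 < a i) {r : ℝ} (hr : r ∈ (P.line u a).roots) : r < 0 := by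
  by_contra! h
  exact (hP.eval_line_pos hu ha h).ne' (Polynomial.isRoot_of_mem_roots hr)

theorem eval_derivative_line_pos (hP : P.IsHStable (k + 1)) {u a : σ → ℝ} (hu : ∀ i, 0 < u i)
    (ha : ∀ i, 0 < a i) : 0 < (Polynomial.derivative (P.line u a)).eval 0 := by
  have h0 := hP.eval_line_pos hu ha le_rfl
  rw [(hP.splits_line hu ha).eval_derivative_eq_eval_mul_sum h0.ne']
  refine mul_pos h0 ?_
  have hcard := (hP.splits_line hu ha).natDegree_eq_card_roots
  rw [hP.natDegree_line u ha] at hcard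
  have hne : (P.line u a).roots ≠ 0 := by
    intro h; simp [h] at hcard
  apply Multiset.map_sum_pos (AddMonoidHom.id ℝ)
  · intro x hx
    obtain ⟨r, hr, rfl⟩ := Multiset.mem_map.1 hx
    have := hP.roots_line_neg hu ha hr
    simp; exact this
  · simpa using hne

variable [Fintype σ]

/-- A Gauss–Lucas argument: along the line through `z` in direction `a`, all roots `r` have negative
real part, so the logarithmic derivative at `0`, which is `∑ 1 / (0 - r)`, has positive real part
and cannot vanish. -/
protected theorem dirDeriv (hP : P.IsHStable (k + 1)) {a : σ → ℝ} (ha : ∀ i, 0 < a i) :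
    (dirDeriv a P).IsHStable k where
  homogeneous := hP.homogeneous.dirDeriv a
  eval_pos x hx := by
    have := hP.eval_derivative_line_pos hx ha
    rw [derivative_line, eval_line] at this
    simpa using this
  eval_ne_zero z hz := by
    set Q := P.map Complex.ofRealHom with hQ
    have hQh : Q.IsHomogeneous (k + 1) := hP.homogeneous.map _
    set b : σ → ℂ := Complex.ofRealHom ∘ a with hb
    have hroot : ∀ s : ℂ, 0 ≤ s.re → (Q.line z b).eval s ≠ 0 := by
      intro s hs
      rw [eval_line]
      refine hP.eval_ne_zero _ fun i => ?_
      have h1 := hz i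
      have h2 := ha i
      simp [hb]
      positivity
    have h0 := hroot 0 le_rfl
    have hsp : (Q.line z b).Splits := IsAlgClosed.splits _
    have h1 : eval z ((dirDeriv a P).map Complex.ofRealHom) =
        (Polynomial.derivative (Q.line z b)).eval 0 := by
      rw [derivative_line, eval_line, map_dirDeriv]
      simp [hQ, hb]
    rw [h1, hsp.eval_derivative_eq_eval_mul_sum h0]
    refine mul_ne_zero h0 fun hsum => ?_
    have hbne : eval b Q ≠ 0 := hP.eval_ne_zero _ fun i => by simpa [hb] using ha i
    have hdeg : k + 1 ≤ (Q.line z b).natDegree := by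
      refine Polynomial.le_natDegree_of_ne_zero ?_
      rwa [coeff_line hQh]
    rw [hsp.natDegree_eq_card_roots] at hdeg
    have hne : (Q.line z b).roots ≠ 0 := by
      intro h; simp [h] at hdeg
    refine (Multiset.map_sum_pos Complex.reAddGroupHom (s := (Q.line z b).roots.map
      fun z => 1 / (0 - z)) ?_ ?_).ne' (by rw [hsum, map_zero])
    · intro x hx
      obtain ⟨r, hr, rfl⟩ := Multiset.mem_map.1 hx
      have hr0 : r.re < 0 := by
        by_contra! h
        exact hroot r h (Polynomial.isRoot_of_mem_roots hr)
      have hrn : r ≠ 0 := by rintro rfl; simp at hr0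
      simp [Complex.inv_re]
      exact div_neg_of_neg_of_pos hr0 (Complex.normSq_pos.2 hrn)
    · simpa using hne

end IsHStable

end MvPolynomial

/-! ### Gurvits's capacity inequality. -/

theorem Multiset.prod_le_arith_mean_pow (s : Multiset ℝ) (hs : ∀ x ∈ s, 0 ≤ x) :
    s.prod ≤ (s.sum / s.card) ^ s.card := by
  induction s using Quotient.inductionOn with
  | h l =>
  rcases Nat.eq_zero_or_pos l.length with h0 | hpos
  · obtain rfl := List.length_eq_zero_iff.1 h0
    simp
  have hl : (0 : ℝ) < l.length := by exact_mod_cast hpos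
  have hnn : ∀ i : Fin l.length, 0 ≤ l[i] := fun i => hs _ (by simp)
  have := Real.geom_mean_le_arith_mean_weighted Finset.univ
    (fun _ : Fin l.length => (l.length : ℝ)⁻¹) (fun i => l[i]) (fun i _ => by positivity)
    (by simp [hl.ne']) (fun i _ => hnn i)
  rw [← Finset.mul_sum] at this
  have h2 := pow_le_pow_left₀ (Finset.prod_nonneg fun i _ => Real.rpow_nonneg (hnn i) _) this
    l.length
  rw [← Finset.prod_pow] at h2
  simp only [← Real.rpow_natCast, ← Real.rpow_mul (hnn _), inv_mul_cancel₀ hl.ne',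
    Real.rpow_one] at h2
  rw [Real.rpow_natCast] at h2
  simpa [Fin.prod_univ_getElem, Fin.sum_univ_getElem, inv_mul_eq_div] using h2

namespace Polynomial

/-- Gurvits's univariate inequality. -/
theorem le_eval_derivative_of_splits {R : Polynomial ℝ} {k : ℕ} (hsp : R.Splits)
    (hdeg : R.natDegree = k + 2) (hroots : ∀ r ∈ R.roots, r < 0) (h0 : 0 < R.eval 0) {c : ℝ}
    (hc : ∀ s : ℝ, 0 < s → c * s ≤ R.eval s) :
    c * (((k : ℝ) + 1) / (k + 2)) ^ (k + 1) ≤ (derivative R).eval 0 := by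
  set S : ℝ := (R.roots.map fun r => 1 / (0 - r)).sum with hS
  have hcard : R.roots.card = k + 2 := by rw [← hsp.natDegree_eq_card_roots, hdeg]
  have hder : (derivative R).eval 0 = R.eval 0 * S :=
    hsp.eval_derivative_eq_eval_mul_sum h0.ne'
  have hSpos : 0 < S := by
    refine Multiset.map_sum_pos (AddMonoidHom.id ℝ) ?_ ?_
    · intro x hx
      obtain ⟨r, hr, rfl⟩ := Multiset.mem_map.1 hx
      simpa using hroots r hr
    · intro h
      simp [Multiset.map_eq_zero.1 h] at hcard
  -- AM–GM applied to the factors `1 + s / (-r)`, which are positive since the roots are negative.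
  have hub : ∀ s : ℝ, 0 < s → R.eval s ≤ R.eval 0 * (1 + s * S / (k + 2)) ^ (k + 2) := by
    intro s hs
    have hev : R.eval s = R.eval 0 * (R.roots.map fun r => 1 + s * (1 / (0 - r))).prod := by
      rw [hsp.eval_eq_prod_roots s, hsp.eval_eq_prod_roots 0, mul_assoc, ← Multiset.prod_map_mul]
      congr 2
      refine Multiset.map_congr rfl fun r hr => ?_
      have := (hroots r hr).ne
      field_simp
      ring
    rw [hev]
    refine mul_le_mul_of_nonneg_left ?_ h0.le
    refine (Multiset.prod_le_arith_mean_pow _ ?_).trans_eq ?_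
    · intro x hx
      obtain ⟨r, hr, rfl⟩ := Multiset.mem_map.1 hx
      have : 0 < 0 - r := by linarith [hroots r hr]
      positivity
    · rw [Multiset.sum_map_add, Multiset.sum_map_mul_left, ← hS, Multiset.card_map, hcard]
      simp [hcard]
      field_simp
      congr 2
      ring
  have hk1 : (0 : ℝ) < k + 1 := by positivity
  have hk2 : (0 : ℝ) < k + 2 := by positivity
  -- This value of `s` minimises `(1 + s S / (k + 2)) ^ (k + 2) / s`.
  have hs : 0 < ((k : ℝ) + 2) / (S * (k + 1)) := by positivity
  have h1 := (hc _ hs).trans (hub _ hs)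
  have h2 : 1 + ((k : ℝ) + 2) / (S * (k + 1)) * S / (k + 2) = (k + 2) / (k + 1) := by
    field_simp
    ring
  rw [h2] at h1
  rw [hder]
  have h3 : 0 < S * (((k : ℝ) + 1) / (k + 2)) ^ (k + 2) := by positivity
  have h4 := mul_le_mul_of_nonneg_right h1 h3.le
  have h5 : (((k : ℝ) + 2) / (k + 1)) ^ (k + 2) * (((k : ℝ) + 1) / (k + 2)) ^ (k + 2) = 1 := by
    rw [← mul_pow, div_mul_div_cancel₀' hk2.ne', div_self hk1.ne', one_pow]
  calc c * (((k : ℝ) + 1) / (k + 2)) ^ (k + 1)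
      = c * (((k : ℝ) + 2) / (S * (k + 1))) * (S * (((k : ℝ) + 1) / (k + 2)) ^ (k + 2)) := by
        rw [pow_succ _ (k + 1)]
        field_simp
    _ ≤ _ := h4
    _ = R.eval 0 * S * ((((k : ℝ) + 2) / (k + 1)) ^ (k + 2) *
          (((k : ℝ) + 1) / (k + 2)) ^ (k + 2)) := by ring
    _ = _ := by rw [h5, mul_one]

end Polynomial

namespace MvPolynomial

variable {σ : Type*} [Fintype σ]

/-- Gurvits's capacity inequality. -/
theorem IsHStable.le_eval_prod_dirDeriv {k : ℕ} : ∀ {P : MvPolynomial σ ℝ}, P.IsHStable k →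
    ∀ {a : Fin k → σ → ℝ}, (∀ j i, 0 < a j i) → ∀ {c : ℝ},
    (∀ x : Fin k → ℝ, (∀ j, 0 < x j) → c * ∏ j, x j ≤ eval (fun i => ∑ j, a j i * x j) P) →
    c * ((k ! : ℝ) / (k : ℝ) ^ k) ≤ eval 0 ((List.ofFn fun j => dirDeriv (a j)).prod P) := by
  induction k with
  | zero =>
    intro P hP a ha c hc
    simpa using hc Fin.elim0 (fun j => j.elim0)
  | succ k ih =>
    intro P hP a ha c hc
    rw [List.ofFn_succ', List.concat_eq_append, List.prod_append, List.prod_singleton,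
      Module.End.mul_apply]
    have hc' : ∀ x : Fin k → ℝ, (∀ j, 0 < x j) → ∀ s : ℝ, 0 < s →
        c * (∏ j, x j) * s ≤ (P.line (fun i => ∑ j, a j.castSucc i * x j) (a (Fin.last k))).eval s := by
      intro x hx s hs
      have := hc (Fin.snoc x s) (fun j => by
        refine Fin.lastCases ?_ (fun j => ?_) j
        · simpa using hs
        · simpa using hx j)
      rw [eval_line]
      simpa [Fin.sum_univ_castSucc, Fin.prod_univ_castSucc, mul_assoc] using this
    have hD : ∀ u : σ → ℝ, eval u (dirDeriv (a (Fin.last k)) P) =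
        (Polynomial.derivative (P.line u (a (Fin.last k)))).eval 0 := by
      intro u
      rw [derivative_line, eval_line]
      simp
    -- With no remaining directions the base point is `0`, outside the open orthant, so stability
    -- says nothing there. The restriction is then linear without constant term and its derivative
    -- is read off directly.
    rcases k with _ | k
    · have h1 := hc' Fin.elim0 (fun j => j.elim0) 1 one_pos
      have h2 : (P.line (fun _ => 0) (a (Fin.last 0))).eval 0 = 0 := by
        rw [eval_line]
        have := hP.homogeneous.eval_mul 0 0
        simpa using this
      have h3 := natDegree_line_le hP.homogeneous (fun _ => 0) (a (Fin.last 0))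
      have h4 := hD (fun _ => 0)
      rw [← Polynomial.coeff_zero_eq_eval_zero] at h2 h4
      rw [Polynomial.coeff_derivative] at h4
      simp only [Finset.univ_eq_empty, Finset.sum_empty, Finset.prod_empty] at h1
      rw [Polynomial.eval_eq_sum_range' (n := 2) (by omega)] at h1
      simp only [Finset.sum_range_succ, h2] at h1
      simp at h4 h1
      simpa [Pi.zero_def, h4] using h1
    -- For each fixed positive `x`, the univariate inequality with constant `c * ∏ x j` shows that
    -- the derivative in the last direction keeps the capacity bound up to the factor `((k + 1) / (k
    -- + 2)) ^ (k + 1)`.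
    · have ih' := ih (hP.dirDeriv (ha (Fin.last _))) (a := fun j => a j.castSucc)
        (fun j i => ha _ i) (c := c * (((k : ℝ) + 1) / (k + 2)) ^ (k + 1)) (fun x hx => by
          have hu : ∀ i, 0 < ∑ j, a (Fin.castSucc j) i * x j := fun i =>
            Finset.sum_pos (fun j _ => mul_pos (ha _ i) (hx j)) Finset.univ_nonempty
          rw [hD]
          have := Polynomial.le_eval_derivative_of_splits (k := k)
            (hP.splits_line hu (ha (Fin.last _)))
            (hP.natDegree_line _ (ha _)) (fun r hr => hP.roots_line_neg hu (ha _) hr)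
            (hP.eval_line_pos hu (ha _) le_rfl) (hc' x hx)
          calc _ = _ := by ring
            _ ≤ _ := this)
      refine le_trans (le_of_eq ?_) ih'
      rw [Nat.factorial_succ (k + 1)]
      push_cast
      have h1 : (k : ℝ) + 1 ≠ 0 := by positivity
      have h2 : (k : ℝ) + 2 ≠ 0 := by positivity
      have h3 : (k : ℝ) + 1 + 1 = k + 2 := by ring
      rw [h3, div_pow, pow_succ _ (k + 1)]
      field_simp

/-! ### The permanent as an iterated derivative, and van der Waerden's bound. -/

theorem isHStable_prod_X : (∏ i, X i : MvPolynomial σ ℝ).IsHStable (Fintype.card σ) where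
  homogeneous := by
    have := IsHomogeneous.prod Finset.univ (fun i : σ => (X i : MvPolynomial σ ℝ)) (fun _ => 1)
      fun i _ => isHomogeneous_X ℝ i
    simpa using this
  eval_pos x hx := by
    rw [map_prod]
    exact Finset.prod_pos fun i _ => by simpa using hx i
  eval_ne_zero z hz := by
    rw [map_prod, map_prod]
    refine Finset.prod_ne_zero_iff.2 fun i _ => ?_
    intro h
    have := hz i
    simp at h
    simp [h] at this

theorem prod_pderiv_prod_X {σ R : Type*} [DecidableEq σ] [CommSemiring R] (l : List σ) (s : Finset σ) :
    (l.map fun i => ((pderiv i).toLinearMap : Module.End R (MvPolynomial σ R))).prod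
      (∏ i ∈ s, X i) = if l.Nodup ∧ l.toFinset ⊆ s then ∏ i ∈ s \ l.toFinset, X i else 0 := by
  induction l with
  | nil => simp
  | cons j l ih =>
    rw [List.map_cons, List.prod_cons, Module.End.mul_apply, ih]
    have hX : ∀ t : Finset σ, pderiv j (∏ i ∈ t, (X i : MvPolynomial σ R)) =
        if j ∈ t then ∏ i ∈ t.erase j, X i else 0 := by
      intro t
      have hnot : ∀ t : Finset σ, j ∉ t → pderiv j (∏ i ∈ t, (X i : MvPolynomial σ R)) = 0 := by
        intro t ht
        refine Finset.prod_induction _ (fun q => pderiv j q = 0) ?_ (by simp) fun i hi => ?_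
        · intro p q hp hq
          simp [Derivation.leibniz, hp, hq]
        · exact pderiv_X_of_ne (by rintro rfl; exact ht hi)
      split_ifs with h
      · rw [← Finset.mul_prod_erase t _ h, Derivation.leibniz, hnot _ (Finset.notMem_erase j t)]
        simp
      · exact hnot t h
    split_ifs with h1 h2 h2
    · refine (hX _).trans ?_
      rw [if_pos]
      · congr 1
        ext i
        simp; tauto
      · simp at h2 ⊢
        exact ⟨h2.2 (by simp), h2.1.1⟩
    · refine (hX _).trans ?_
      rw [if_neg]
      intro h3
      apply h2
      simp at h3 h1 ⊢
      refine ⟨⟨h3.2, h1.1⟩, ?_⟩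
      intro i hi
      rcases Finset.mem_insert.1 hi with rfl | hi
      · exact h3.1
      · exact h1.2 hi
    · exfalso
      apply h1
      simp at h2 ⊢
      exact ⟨h2.1.2, fun i hi => h2.2 (Finset.mem_insert_of_mem hi)⟩
    · exact map_zero _

variable [DecidableEq σ]

theorem prod_dirDeriv_prod_X {K : Type*} [Field K] {m : ℕ} (a : Fin m → σ → K) :
    (List.ofFn fun j => dirDeriv (a j)).prod (∏ i, X i) =
      ∑ r : Fin m → σ, (∏ j, a j (r j)) •
        if r.Injective then (∏ i ∈ (Finset.univ.image r)ᶜ, X i : MvPolynomial σ K) else 0 := by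
  have h := (MultilinearMap.mkPiAlgebraFin K m (Module.End K (MvPolynomial σ K))).map_sum
    (fun j i => a j i • (pderiv i).toLinearMap)
  simp only [MultilinearMap.map_smul_univ, MultilinearMap.mkPiAlgebraFin_apply] at h
  unfold dirDeriv
  rw [h, LinearMap.sum_apply]
  refine Finset.sum_congr rfl fun r _ => ?_
  rw [LinearMap.smul_apply]
  congr 1
  have := prod_pderiv_prod_X (R := K) (List.ofFn r) Finset.univ
  rw [List.map_ofFn] at this
  refine this.trans ?_
  have h2 : (List.ofFn r).toFinset = Finset.univ.image r := by ext; simp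
  simp [List.nodup_ofFn, h2, Finset.compl_eq_univ_sdiff]

end MvPolynomial

namespace Matrix

open MvPolynomial

variable {ι : Type*} [Fintype ι] [DecidableEq ι]

/-- Expanding the derivatives multilinearly, a choice of variables with a repetition kills `∏ X i`.
The injective choices are the permutations, each leaving the empty product. -/
theorem permanent_eq_eval_prod_dirDeriv (A : Matrix ι ι ℝ) (e : Fin (Fintype.card ι) ≃ ι) :
    A.permanent = eval 0 ((List.ofFn fun j => dirDeriv fun i => A i (e j)).prod (∏ i, X i)) := by
  rw [prod_dirDeriv_prod_X, map_sum, permanent]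
  have hcard : ∀ r : Fin (Fintype.card ι) → ι, r.Injective → r.Bijective := fun r hr =>
    (Fintype.bijective_iff_injective_and_card r).2 ⟨hr, by simp⟩
  symm
  refine Finset.sum_of_injOn (fun σ : Equiv.Perm ι => fun j => σ (e j)) ?_ ?_ ?_ ?_ |>.symm
  · intro σ _ τ _ h
    ext i
    have := congrFun h (e.symm i)
    simpa using this
  · intro σ _; simp
  · intro r _ hr
    rw [if_neg]
    · simp
    · intro hinj
      refine hr ⟨e.symm.trans (Equiv.ofBijective r (hcard r hinj)), by simp, ?_⟩
      funext j
      simp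
  · intro σ _
    have hinj : Function.Injective fun j => σ (e j) := σ.injective.comp e.injective
    rw [if_pos hinj, Finset.image_univ_of_surjective (hcard _ hinj).2]
    simp
    exact (e.prod_comp fun i => A (σ i) i).symm

/-- The van der Waerden bound for positive doubly stochastic matrices. -/
theorem factorial_div_pow_le_permanent {A : Matrix ι ι ℝ} (hpos : ∀ i j, 0 < A i j)
    (hA : A ∈ doublyStochastic ℝ ι) :
    ((Fintype.card ι)! : ℝ) / (Fintype.card ι : ℝ) ^ Fintype.card ι ≤ A.permanent := by
  obtain ⟨-, hrow, hcol⟩ := mem_doublyStochastic_iff_sum.1 hA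
  set e := (Fintype.equivFin ι).symm
  rw [permanent_eq_eval_prod_dirDeriv A e]
  have := isHStable_prod_X.le_eval_prod_dirDeriv (a := fun j i => A i (e j))
    (fun j i => hpos i _) (c := 1) ?_
  · simpa using this
  intro x hx
  rw [map_prod, one_mul]
  -- The capacity is at least `1`: column sums distribute each `x j` over the rows, then weighted
  -- AM–GM applies in each row because the row sums are `1`.
  calc ∏ j, x j = ∏ j, x j ^ (∑ i, A i (e j)) := by simp [hcol]
    _ = ∏ j, ∏ i, x j ^ A i (e j) := by
        refine Finset.prod_congr rfl fun j _ => ?_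
        rw [Real.rpow_sum_of_pos (hx j)]
    _ = ∏ i, ∏ j, x j ^ A i (e j) := Finset.prod_comm
    _ ≤ _ := by
        refine Finset.prod_le_prod (fun i _ => Finset.prod_nonneg fun j _ =>
          Real.rpow_nonneg (hx j).le _) fun i _ => ?_
        rw [eval_X]
        refine Real.geom_mean_le_arith_mean_weighted Finset.univ (fun j => A i (e j)) x
          (fun j _ => (hpos _ _).le) ?_ (fun j _ => (hx j).le)
        rw [e.sum_comp fun j => A i j]
        exact hrow i

end Matrix

/-! ### Contingency tables and the number of magic squares. -/

namespace ContingencyTable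

open Finset

/-- The number of vectors in the box `∏ j, {0, …, c j}` with coordinate sum `a`. -/
def boxCount {m : ℕ} (c : Fin m → ℕ) (a : ℤ) : ℕ :=
  #{x ∈ Fintype.piFinset fun j => range (c j + 1) | ∑ j, (x j : ℤ) = a}

theorem boxCount_succ {m : ℕ} (c : Fin (m + 1) → ℕ) (a : ℤ) :
    boxCount c a = ∑ i ∈ range (c 0 + 1), boxCount (Fin.tail c) (a - i) := by
  rw [boxCount, card_eq_sum_card_fiberwise (f := fun x => x 0) (t := range (c 0 + 1))]
  · refine sum_congr rfl fun i hi => ?_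
    refine card_nbij' Fin.tail (fun x => (Fin.cons i x : Fin (m + 1) → ℕ)) ?_ ?_ ?_ ?_
    · intro x hx
      simp [Fin.sum_univ_succ, Fin.tail] at hx ⊢
      refine ⟨fun j => hx.1.1 j.succ, ?_⟩
      have := hx.1.2
      rw [hx.2] at this
      linarith
    · intro x hx
      simp [Fin.sum_univ_succ, Fin.tail, Fin.forall_fin_succ] at hx hi ⊢
      refine ⟨⟨hi, hx.1⟩, ?_⟩
      linarith [hx.2]
    · intro x hx
      simp at hx
      rw [← hx.2]
      exact Fin.cons_self_tail x
    · intro x _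
      exact Fin.tail_cons _ _
  · intro x hx
    simp at hx ⊢
    exact hx.1 0

/-- Adding a coordinate replaces the counting function by its sums over windows of `c 0 + 1`
consecutive integers, which preserves symmetry and unimodality. Integer arguments let windows run
below zero. -/
theorem boxCount_symm_unimodal {m : ℕ} : ∀ c : Fin m → ℕ,
    (∀ a, boxCount c (∑ j, (c j : ℤ) - a) = boxCount c a) ∧
      ∀ a b, a ≤ b → a + b ≤ ∑ j, (c j : ℤ) → boxCount c a ≤ boxCount c b := by
  induction m with
  | zero =>
    intro c
    have h : ∀ a : ℤ, boxCount c a = if 0 = a then 1 else 0 := by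
      intro a
      simp only [boxCount, univ_eq_empty, sum_empty]
      split_ifs with h <;> simp [h]
    simp only [univ_eq_empty, sum_empty, h]
    refine ⟨fun a => by congr 1; simp [eq_comm], fun a b h1 h2 => ?_⟩
    split_ifs <;> omega
  | succ m ih =>
    intro c
    obtain ⟨hs, hm⟩ := ih (Fin.tail c)
    set s := ∑ j, (Fin.tail c j : ℤ) with hsdef
    have hsum : ∑ j, (c j : ℤ) = s + c 0 := by
      rw [Fin.sum_univ_succ, add_comm]; rfl
    rw [hsum]
    have hsymm : ∀ a, boxCount c (s + c 0 - a) = boxCount c a := by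
      intro a
      rw [boxCount_succ, boxCount_succ, ← sum_range_reflect]
      refine sum_congr rfl fun i hi => ?_
      rw [← hs]
      congr 1
      have := mem_range.1 hi
      rw [Nat.cast_sub (by omega)]
      push_cast
      ring
    -- Shifting the window by one gains the value at `a + 1` and loses the one at `a - c 0`, which
    -- is no closer to the centre `s / 2`.
    have hstep : ∀ a, 2 * a + 1 ≤ s + c 0 → boxCount c a ≤ boxCount c (a + 1) := by
      intro a ha
      rw [boxCount_succ, boxCount_succ, sum_range_succ, sum_range_succ']
      refine add_le_add (le_of_eq ?_) (hm _ _ (by push_cast; omega) (by push_cast; omega))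
      refine sum_congr rfl fun i _ => ?_
      congr 1
      push_cast
      ring
    have hchain : ∀ a b, a ≤ b → 2 * b - 1 ≤ s + c 0 → boxCount c a ≤ boxCount c b := by
      intro a b hab
      induction b, hab using Int.leInduction with
      | base => intro _; exact le_rfl
      | succ b hb ihb =>
        intro h
        exact (ihb (by omega)).trans (hstep b (by omega))
    refine ⟨hsymm, fun a b hab h => ?_⟩
    by_cases h2 : 2 * b - 1 ≤ s + c 0
    · exact hchain a b hab h2
    · rw [← hsymm b]
      exact hchain _ _ (by omega) (by omega)

/-- The contingency tables with row sums `r` and column sums `c`. -/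
def tables {n : ℕ} (r c : Fin n → ℕ) : Finset (Fin n → Fin n → ℕ) :=
  {D ∈ Fintype.piFinset fun i => piAntidiag univ (r i) | ∀ j, ∑ i, D i j = c j}

theorem mem_tables {n : ℕ} {r c : Fin n → ℕ} {D : Fin n → Fin n → ℕ} :
    D ∈ tables r c ↔ (∀ i, ∑ j, D i j = r i) ∧ ∀ j, ∑ i, D i j = c j := by
  simp [tables]

theorem card_tables_transpose {n : ℕ} (r c : Fin n → ℕ) : #(tables r c) = #(tables c r) := by
  refine card_nbij' (fun D i j => D j i) (fun D i j => D j i) ?_ ?_ ?_ ?_ <;> intro D hD <;>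
    simp [mem_tables] at hD ⊢ <;> exact ⟨hD.2, hD.1⟩

theorem sum_update_update {n : ℕ} {M : Type*} [AddCommMonoid M] {p q : Fin n} (hpq : p ≠ q)
    (g : Fin n → M) (x y : M) :
    ∑ i, Function.update (Function.update g p x) q y i =
      x + y + ∑ i ∈ (univ.erase p).erase q, g i := by
  rw [← add_sum_erase univ _ (mem_univ p),
    ← add_sum_erase _ _ (show q ∈ univ.erase p by simp [hpq.symm])]
  rw [Function.update_of_ne hpq, Function.update_self, Function.update_self, add_assoc]
  congr 2
  refine sum_congr rfl fun i hi => ?_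
  simp at hi
  rw [Function.update_of_ne hi.1, Function.update_of_ne hi.2]

/-- Merging rows `p` and `q` fibres the tables over tables whose row `q` vanishes. -/
theorem card_tables_eq_sum {n : ℕ} {p q : Fin n} (hpq : p ≠ q) (r c : Fin n → ℕ) :
    #(tables r c) =
      ∑ E ∈ tables (Function.update (Function.update r p (r p + r q)) q 0) c,
        boxCount (E p) (r p) := by
  let merge : (Fin n → Fin n → ℕ) → Fin n → Fin n → ℕ := fun D =>
    Function.update (Function.update D p (D p + D q)) q 0
  have hcol : ∀ (D : Fin n → Fin n → ℕ) j, ∑ i, D i j =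
      D p j + D q j + ∑ i ∈ (univ.erase p).erase q, D i j := by
    intro D j
    rw [← add_sum_erase univ _ (mem_univ p),
      ← add_sum_erase _ _ (show q ∈ univ.erase p by simp [hpq.symm]), add_assoc]
  rw [card_eq_sum_card_fiberwise (f := merge)
    (t := tables (Function.update (Function.update r p (r p + r q)) q 0) c)]
  · refine sum_congr rfl fun E hE => ?_
    rw [mem_tables] at hE
    have hEq : E q = 0 := by
      have := hE.1 q
      rw [Function.update_self] at this
      funext j
      exact (sum_eq_zero_iff.1 this) j (mem_univ j)
    have hEp : ∑ j, E p j = r p + r q := by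
      have := hE.1 p
      rwa [Function.update_of_ne hpq, Function.update_self] at this
    have hEi : ∀ i, i ≠ p → i ≠ q → ∑ j, E i j = r i := by
      intro i hp hq
      have := hE.1 i
      rwa [Function.update_of_ne hq, Function.update_of_ne hp] at this
    -- Over a merged table `E`, the table `D` is determined by its row `p`: any vector below `E p`
    -- with sum `r p`, row `q` being the rest.
    refine card_nbij' (fun D => D p)
      (fun x => Function.update (Function.update E p x) q (E p - x)) ?_ ?_ ?_ ?_
    · intro D hD
      simp only [coe_filter, mem_tables, Set.mem_ofPred_eq, Fintype.mem_piFinset, mem_range] at hD ⊢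
      refine ⟨fun j => ?_, by exact_mod_cast hD.1.1 p⟩
      rw [← hD.2]
      simp [merge, Function.update_of_ne hpq]
    · intro x hx
      simp only [coe_filter, mem_tables, Set.mem_ofPred_eq, Fintype.mem_piFinset, mem_range] at hx ⊢
      have hxs : ∑ j, x j = r p := by exact_mod_cast hx.2
      have hle : ∀ j, x j ≤ E p j := fun j => Nat.lt_succ_iff.1 (hx.1 j)
      refine ⟨⟨fun i => ?_, fun j => ?_⟩, ?_⟩
      · by_cases hq : i = q
        · subst hq
          simp only [Function.update_self, Pi.sub_apply]
          rw [sum_tsub_distrib _ fun j _ => hle j, hEp, hxs]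
          omega
        · rw [Function.update_of_ne hq]
          by_cases hp : i = p
          · subst hp
            simpa using hxs
          · rw [Function.update_of_ne hp]
            exact hEi i hp hq
      · rw [hcol, ← hE.2 j, hcol E]
        simp only [Function.update_self, Function.update_of_ne hpq, hEq, Pi.sub_apply]
        congr 1
        · have := hle j
          simp
          omega
        · refine sum_congr rfl fun i hi => ?_
          simp at hi
          rw [Function.update_of_ne hi.1, Function.update_of_ne hi.2]
      · funext i j
        by_cases hq : i = q
        · subst hq; simp [merge, hEq]
        · by_cases hp : i = p
          · subst hp
            have := hle j
            simp [merge, hq]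
            omega
          · simp [merge, hq, hp]
    · intro D hD
      simp only [coe_filter, Set.mem_ofPred_eq] at hD
      rw [← hD.2]
      funext i j
      by_cases hq : i = q
      · subst hq; simp [merge, hpq]
      · by_cases hp : i = p
        · subst hp; simp [hq]
        · simp [merge, hq, hp]
    · intro x _
      simp [hpq]
  · intro D hD
    rw [mem_coe, mem_tables] at hD ⊢
    refine ⟨fun i => ?_, fun j => ?_⟩
    · by_cases hq : i = q
      · subst hq; simp [merge]
      · by_cases hp : i = p
        · subst hp
          simp [merge, hq, sum_add_distrib, hD.1]
        · simp [merge, hq, hp, hD.1]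
    · rw [← hD.2 j, hcol, hcol D]
      simp only [merge, Function.update_self, Function.update_of_ne hpq]
      congr 1
      refine sum_congr rfl fun i hi => ?_
      simp at hi
      rw [Function.update_of_ne hi.1, Function.update_of_ne hi.2]

/-- Moving one unit from a row with a larger sum to a row with a smaller sum does not decrease the
number of tables. -/
theorem card_tables_le_transfer {n : ℕ} {p q : Fin n} (r c : Fin n → ℕ)
    (hr : r q + 2 ≤ r p) :
    #(tables r c) ≤
      #(tables (Function.update (Function.update r p (r p - 1)) q (r q + 1)) c) := by
  have hpq : p ≠ q := by rintro rfl; omega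
  rw [card_tables_eq_sum hpq, card_tables_eq_sum hpq]
  simp only [Function.update_of_ne hpq, Function.update_self]
  have h1 : Function.update (Function.update (Function.update (Function.update r p (r p - 1)) q
      (r q + 1)) p (r p - 1 + (r q + 1))) q 0 =
      Function.update (Function.update r p (r p + r q)) q 0 := by
    funext i
    by_cases hq : i = q
    · subst hq; simp
    · by_cases hp : i = p
      · subst hp; simp [hq]; omega
      · simp [hq, hp]
  rw [h1]
  refine sum_le_sum fun E hE => ?_
  have hEp : ∑ j, (E p j : ℤ) = r p + r q := by
    have := (mem_tables.1 hE).1 p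
    rw [Function.update_of_ne hpq, Function.update_self] at this
    exact_mod_cast this
  obtain ⟨hs, hm⟩ := boxCount_symm_unimodal (E p)
  -- Reflection turns the levels `r p` and `r p - 1` into `r q` and `r q + 1`, both on the
  -- increasing side.
  rw [← hs (r p), hEp]
  rw [← hs ((r p - 1 : ℕ) : ℤ), hEp]
  refine hm _ _ (by omega) ?_
  rw [hEp]
  omega

theorem card_tables_le_const {n t : ℕ} (r c : Fin n → ℕ) (hr : ∑ i, r i = n * t) :
    #(tables r c) ≤ #(tables (fun _ => t) c) := by
  -- A transfer from a row sum above `t` to one below strictly lowers the sum of squares.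
  induction hk : ∑ i, r i ^ 2 using Nat.strong_induction_on generalizing r with
  | h k ih =>
  by_cases hconst : ∀ i, r i = t
  · rw [show r = fun _ => t from funext hconst]
  push Not at hconst
  obtain ⟨i₀, hi₀⟩ := hconst
  have hst : ∑ i, r i = ∑ _i : Fin n, t := by simp [hr]
  obtain ⟨p, hp⟩ : ∃ p, t < r p := by
    by_contra! h
    exact hi₀ ((sum_eq_sum_iff_of_le fun i _ => h i).1 hst i₀ (mem_univ _))
  obtain ⟨q, hq⟩ : ∃ q, r q < t := by
    by_contra! h
    exact hi₀ ((sum_eq_sum_iff_of_le fun i _ => h i).1 hst.symm i₀ (mem_univ _)).symm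
  have hpq : p ≠ q := by rintro rfl; omega
  refine (card_tables_le_transfer (p := p) (q := q) r c (by omega)).trans (ih _ ?_ _ ?_ rfl)
  · have h1 : ∀ i, Function.update (Function.update r p (r p - 1)) q (r q + 1) i ^ 2 =
        Function.update (Function.update (fun i => r i ^ 2) p ((r p - 1) ^ 2)) q
          ((r q + 1) ^ 2) i := by
      intro i
      by_cases hq : i = q
      · subst hq; simp
      · by_cases hp : i = p
        · subst hp; simp [hq]
        · simp [hq, hp]
    simp only [h1]
    have h2 := sum_update_update hpq (fun i => r i ^ 2) (r p ^ 2) (r q ^ 2)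
    rw [sum_update_update hpq, ← hk]
    simp only [Function.update_eq_self] at h2
    rw [h2]
    obtain ⟨x, hx⟩ : ∃ x, r p = x + 1 := ⟨r p - 1, by omega⟩
    rw [hx]
    simp only [Nat.add_sub_cancel]
    have : r q < x := by omega
    nlinarith
  · rw [sum_update_update hpq, ← hr]
    have h2 := sum_update_update hpq r (r p) (r q)
    rw [Function.update_eq_self_iff.2 (by simp), Function.update_eq_self_iff.2 rfl] at h2
    rw [h2]
    omega

theorem card_tables_le {n t : ℕ} (r c : Fin n → ℕ) (hr : ∑ i, r i = n * t)
    (hc : ∑ i, c i = n * t) : #(tables r c) ≤ #(tables (n := n) (fun _ => t) fun _ => t) :=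
  (card_tables_le_const r c hr).trans <| by
    rw [card_tables_transpose]
    exact card_tables_le_const c _ hc

theorem card_piAntidiag_univ {ι : Type*} [Fintype ι] [DecidableEq ι] [Nonempty ι] (N : ℕ) :
    #(piAntidiag (univ : Finset ι) N) =
      (N + Fintype.card ι - 1).choose (Fintype.card ι - 1) := by
  have hpos : 0 < Fintype.card ι := Fintype.card_pos
  rw [← map_sym_eq_piAntidiag, card_map, sym_univ, card_univ, Sym.card_sym_eq_choose]
  rw [← Nat.choose_symm (by omega)]
  congr 1 <;> omega

theorem mem_magicSquares_iff {n t : ℕ} {D : Matrix (Fin n) (Fin n) ℕ} :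
    D ∈ MagicSquares.magicSquares n t ↔ D ∈ tables (n := n) (fun _ => t) fun _ => t :=
  (mem_tables (D := fun i j => D i j)).symm

theorem ncard_magicSquares (n t : ℕ) :
    (MagicSquares.magicSquares n t).ncard = #(tables (n := n) (fun _ => t) fun _ => t) := by
  rw [← Set.ncard_coe_finset]
  congr 1
  ext D
  exact mem_magicSquares_iff

theorem ncard_magicSquares_le {n : ℕ} (t : ℕ) (hn : 0 < n) :
    (MagicSquares.magicSquares n t).ncard ≤ (n * t + n ^ 2 - 1).choose (n ^ 2 - 1) := by
  have : Nonempty (Fin n × Fin n) := ⟨⟨0, hn⟩, ⟨0, hn⟩⟩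
  have h := card_piAntidiag_univ (ι := Fin n × Fin n) (n * t)
  rw [Fintype.card_prod, Fintype.card_fin, ← sq] at h
  rw [ncard_magicSquares, ← h]
  refine card_le_card_of_injOn (fun D x => D x.1 x.2) ?_ ?_
  · intro D hD
    simp [mem_tables, Fintype.sum_prod_type] at hD ⊢
    simp [hD.1]
  · intro D _ D' _ h
    funext i j
    exact congrFun h (i, j)

theorem choose_le_pow_mul_ncard_magicSquares {n : ℕ} (t : ℕ) (hn : 0 < n) :
    (n * t + n ^ 2 - 1).choose (n ^ 2 - 1) ≤
      (n * t + n) ^ (2 * n) * (MagicSquares.magicSquares n t).ncard := by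
  have : Nonempty (Fin n × Fin n) := ⟨⟨0, hn⟩, ⟨0, hn⟩⟩
  have h := card_piAntidiag_univ (ι := Fin n × Fin n) (n * t)
  rw [Fintype.card_prod, Fintype.card_fin, ← sq] at h
  rw [ncard_magicSquares, ← h]
  let margins : Finset (Fin n → ℕ) := piAntidiag univ (n * t)
  have hmargins : #margins ≤ (n * t + n) ^ n := by
    calc #margins ≤ #(Fintype.piFinset fun _ : Fin n => range (n * t + 1)) := by
          refine card_le_card fun r hr => ?_
          simp [margins] at hr ⊢
          intro i
          exact
            ((single_le_sum (f := r) (fun _ _ => Nat.zero_le _) (mem_univ i)).trans_eq hr)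
      _ = (n * t + 1) ^ n := by simp
      _ ≤ _ := Nat.pow_le_pow_left (by omega) n
  have hle : #(piAntidiag (univ : Finset (Fin n × Fin n)) (n * t)) ≤
      #(tables (n := n) (fun _ => t) fun _ => t) * #(margins ×ˢ margins) := by
    refine card_le_mul_card_image_of_maps_to
      (f := fun D => (fun i => ∑ j, D (i, j), fun j => ∑ i, D (i, j))) ?_ _ ?_
    · intro D hD
      simp [margins] at hD ⊢
      rw [sum_comm (f := fun j i => D (i, j)), ← Fintype.sum_prod_type]
      simp [hD]
    · rintro ⟨r, c⟩ hrc
      simp [margins] at hrc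
      refine le_trans ?_ (card_tables_le r c hrc.1 hrc.2)
      refine card_le_card_of_injOn (fun D i j => D (i, j)) ?_ ?_
      · intro D hD
        simp [mem_tables] at hD ⊢
        exact ⟨congrFun hD.2.1, congrFun hD.2.2⟩
      · intro D _ D' _ h
        funext x
        exact congrFun (congrFun h x.1) x.2
  refine hle.trans ?_
  rw [mul_comm, card_product, two_mul, pow_add]
  exact Nat.mul_le_mul_right _ (Nat.mul_le_mul hmargins hmargins)

end ContingencyTable

/-! ### A Stirling bound and estimates for permanents of `X ⊗ J_t`. -/

theorem Nat.factorial_le_sqrt_mul_div_exp_pow {t : ℕ} (ht : 0 < t) :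
    (t ! : ℝ) ≤ √(8 * t) * (t / Real.exp 1) ^ t := by
  obtain ⟨s, rfl⟩ : ∃ s, t = s + 1 := ⟨t - 1, by omega⟩
  -- The Stirling sequence decreases from its value `e / √2` at `1`, so `t! ≤ e √t (t / e) ^ t`; the
  -- constant `8` comes from `e ^ 2 < 8`.
  have h1 := Stirling.stirlingSeq'_antitone (Nat.zero_le s)
  simp only [Function.comp_apply, Nat.succ_eq_add_one, zero_add, Stirling.stirlingSeq_one] at h1
  rw [Stirling.stirlingSeq, div_le_iff₀ (by positivity)] at h1
  refine h1.trans ?_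
  rw [← mul_assoc]
  refine mul_le_mul_of_nonneg_right ?_ (by positivity)
  rw [Real.sqrt_mul (by norm_num) ((s + 1 : ℕ) : ℝ), Real.sqrt_mul (by norm_num), ← mul_assoc,
    div_mul_cancel₀ _ (by positivity)]
  refine mul_le_mul_of_nonneg_right ?_ (by positivity)
  refine Real.le_sqrt_of_sq_le ?_
  nlinarith [Real.exp_one_lt_d9, Real.exp_pos 1]

namespace MagicSquares

variable {n t : ℕ}

/-- A non-empty fibre is translated by the inverse of one of its members into the stabiliser of the
block projection, which has order `(t!) ^ n`. -/
theorem card_perm_fst_comp_le (ρ : Fin n × Fin t → Fin n) :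
    (Finset.univ.filter fun σ : Equiv.Perm (Fin n × Fin t) => (fun k => (σ k).1) = ρ).card ≤
      (t !) ^ n := by
  rcases Finset.eq_empty_or_nonempty
    (Finset.univ.filter fun σ : Equiv.Perm (Fin n × Fin t) => (fun k => (σ k).1) = ρ) with h | ⟨τ, hτ⟩
  · rw [h]; simp
  have hstab := DomMulAct.stabilizer_card (α := Fin n × Fin t) (Prod.fst : _ → Fin n)
  have hfib : ∀ i : Fin n, Fintype.card {a : Fin n × Fin t // a.1 = i} = t := by
    intro i
    refine (Fintype.card_congr ⟨fun a => a.1.2, fun b => ⟨(i, b), rfl⟩, ?_, fun _ => rfl⟩).trans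
      (Fintype.card_fin t)
    rintro ⟨⟨j, b⟩, rfl⟩
    rfl
  simp only [hfib, Finset.prod_const, Finset.card_univ, Fintype.card_fin] at hstab
  rw [← hstab, Fintype.card_subtype]
  refine Finset.card_le_card_of_injOn (fun σ => σ * τ⁻¹) ?_ ?_
  · intro σ hσ
    simp only [Finset.mem_filter, Finset.coe_filter, Finset.mem_univ, true_and, Set.mem_ofPred_eq] at hσ hτ ⊢
    funext k
    have h1 := congrFun (hσ.trans hτ.symm) (τ⁻¹ k)
    simpa using h1
  · intro σ _ σ' _ h
    exact mul_right_cancel h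

theorem sum_perm_le (g : (Fin n × Fin t → Fin n) → ℝ) (hg : ∀ ρ, 0 ≤ g ρ) :
    ∑ σ : Equiv.Perm (Fin n × Fin t), g (fun k => (σ k).1) ≤ ((t ! : ℕ) : ℝ) ^ n * ∑ ρ, g ρ := by
  rw [← Finset.sum_fiberwise Finset.univ
    (fun σ : Equiv.Perm (Fin n × Fin t) => fun k => (σ k).1), Finset.mul_sum]
  refine Finset.sum_le_sum fun ρ _ => ?_
  rw [Finset.sum_congr rfl (g := fun _ => g ρ)
    fun σ hσ => by rw [(Finset.mem_filter.1 hσ).2], Finset.sum_const, nsmul_eq_mul]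
  exact mul_le_mul_of_nonneg_right (by exact_mod_cast card_perm_fst_comp_le ρ) (hg ρ)

theorem permanent_kronecker_J (X : Matrix (Fin n) (Fin n) ℝ) :
    (X ⊗ₖ J t).permanent = (∑ σ : Equiv.Perm (Fin n × Fin t), ∏ k, X (σ k).1 k.1) /
      (t : ℝ) ^ (n * t) := by
  simp [Matrix.permanent, J, Finset.prod_mul_distrib, Finset.sum_mul, div_eq_mul_inv]

theorem permanent_kronecker_J_nonneg {X : Matrix (Fin n) (Fin n) ℝ} (hX : ∀ i j, 0 ≤ X i j) :
    0 ≤ (X ⊗ₖ J t).permanent := by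
  rw [permanent_kronecker_J]
  exact div_nonneg (Finset.sum_nonneg fun σ _ => Finset.prod_nonneg fun k _ => hX _ _)
    (by positivity)

theorem permanent_kronecker_J_le_of_col_sum {X : Matrix (Fin n) (Fin n) ℝ}
    (hX : ∀ i j, 0 ≤ X i j) (hcol : ∀ j, ∑ i, X i j = 1) :
    (X ⊗ₖ J t).permanent ≤ (t ! : ℝ) ^ n / (t : ℝ) ^ (n * t) := by
  rw [permanent_kronecker_J]
  refine div_le_div_of_nonneg_right ?_ (by positivity)
  refine (sum_perm_le (fun ρ => ∏ k, X (ρ k) k.1) fun ρ =>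
    Finset.prod_nonneg fun k _ => hX _ _).trans_eq ?_
  have := Finset.prod_univ_sum (fun _ : Fin n × Fin t => (Finset.univ : Finset (Fin n)))
    fun k i => X i k.1
  rw [Fintype.piFinset_univ] at this
  rw [← this]
  simp [hcol]

theorem permanent_kronecker_J_le_of_sum {X : Matrix (Fin n) (Fin n) ℝ}
    (hX : ∀ i j, 0 ≤ X i j) (hsum : ∑ i, ∑ j, X i j = 1) :
    (X ⊗ₖ J t).permanent ≤ (t ! : ℝ) ^ (2 * n) / (((n * t)! : ℝ) * (t : ℝ) ^ (n * t)) := by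
  rw [permanent_kronecker_J, ← div_div]
  refine div_le_div_of_nonneg_right ?_ (by positivity)
  rw [le_div_iff₀ (by positivity)]
  -- Averaging over a second permutation `π` of the columns costs a factor `N!` and lets both
  -- indices be relaxed to arbitrary block maps, each at the price `(t!) ^ n`.
  have hreindex : ∀ π : Equiv.Perm (Fin n × Fin t),
      ∑ σ : Equiv.Perm (Fin n × Fin t), ∏ k, X (σ k).1 (π k).1 =
        ∑ σ : Equiv.Perm (Fin n × Fin t), ∏ k, X (σ k).1 k.1 := by
    intro π
    rw [← Equiv.sum_comp (Equiv.mulRight π)]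
    refine Finset.sum_congr rfl fun σ _ => ?_
    exact Equiv.prod_comp π fun k => X (σ k).1 k.1
  have h1 : (∑ σ : Equiv.Perm (Fin n × Fin t), ∏ k, X (σ k).1 k.1) * ((n * t)! : ℝ) =
      ∑ π : Equiv.Perm (Fin n × Fin t), ∑ σ : Equiv.Perm (Fin n × Fin t),
        ∏ k, X (σ k).1 (π k).1 := by
    simp only [hreindex, Finset.sum_const, Finset.card_univ, Fintype.card_perm, Fintype.card_prod,
      Fintype.card_fin, nsmul_eq_mul]
    ring
  have h2 : ∑ κ : Fin n × Fin t → Fin n, ∑ ρ : Fin n × Fin t → Fin n, ∏ k, X (ρ k) (κ k) = 1 := by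
    have hρ : ∀ κ : Fin n × Fin t → Fin n,
        ∑ ρ : Fin n × Fin t → Fin n, ∏ k, X (ρ k) (κ k) = ∏ k, ∑ i, X i (κ k) := by
      intro κ
      have := Finset.prod_univ_sum (fun _ : Fin n × Fin t => (Finset.univ : Finset (Fin n)))
        fun k i => X i (κ k)
      rw [Fintype.piFinset_univ] at this
      exact this.symm
    have hκ := Finset.prod_univ_sum (fun _ : Fin n × Fin t => (Finset.univ : Finset (Fin n)))
      fun _ j => ∑ i, X i j
    rw [Fintype.piFinset_univ] at hκ
    simp only [hρ]
    rw [← hκ, Finset.sum_comm, hsum]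
    simp
  rw [h1]
  calc _ ≤ ((t ! : ℕ) : ℝ) ^ n * ∑ κ : Fin n × Fin t → Fin n,
        ∑ σ : Equiv.Perm (Fin n × Fin t), ∏ k, X (σ k).1 (κ k) :=
      sum_perm_le (fun κ => ∑ σ : Equiv.Perm (Fin n × Fin t), ∏ k, X (σ k).1 (κ k)) fun κ =>
        Finset.sum_nonneg fun σ _ => Finset.prod_nonneg fun k _ => hX _ _
    _ ≤ ((t ! : ℕ) : ℝ) ^ n * ∑ κ : Fin n × Fin t → Fin n,
        (((t ! : ℕ) : ℝ) ^ n * ∑ ρ : Fin n × Fin t → Fin n, ∏ k, X (ρ k) (κ k)) := by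
      refine mul_le_mul_of_nonneg_left (Finset.sum_le_sum fun κ _ => ?_) (by positivity)
      exact sum_perm_le (fun ρ => ∏ k, X (ρ k) (κ k)) fun ρ =>
        Finset.prod_nonneg fun k _ => hX _ _
    _ = _ := by rw [← Finset.mul_sum, h2]; ring

theorem kronecker_J_mem_doublyStochastic (ht : 0 < t) {Y : Matrix (Fin n) (Fin n) ℝ}
    (hY : Y ∈ doublyStochastic ℝ (Fin n)) :
    Y ⊗ₖ J t ∈ doublyStochastic ℝ (Fin n × Fin t) := by
  obtain ⟨h0, hr, hc⟩ := mem_doublyStochastic_iff_sum.1 hY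
  have ht' : (t : ℝ) ≠ 0 := by positivity
  refine mem_doublyStochastic_iff_sum.2 ⟨fun i j => ?_, fun i => ?_, fun j => ?_⟩
  · have := h0 i.1 j.1
    simp only [Matrix.kroneckerMap_apply, J, Matrix.of_apply]
    positivity
  · simp [Fintype.sum_prod_type, J, ← Finset.mul_sum, ← Finset.sum_mul, hr, ht']
  · simp [Fintype.sum_prod_type, J, ← Finset.mul_sum, ← Finset.sum_mul, hc, ht']

theorem isScaling_scaling (X : Matrix (Fin n) (Fin n) ℝ) (hX : ∀ i j, 0 < X i j) :
    IsScaling X (scaling X hX) :=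
  (exists_isScaling X hX).choose_spec

theorem one_le_p (hn : 0 < n) (ht : 0 < t) (X : simplex n) : 1 ≤ p t X := by
  have hs := isScaling_scaling X.1 X.2.1
  have h := Matrix.factorial_div_pow_le_permanent (A := scaling X.1 X.2.1 ⊗ₖ J t)
    (fun i j => by
      have := hs.pos i.1 j.1
      simp only [Matrix.kroneckerMap_apply, J, Matrix.of_apply]
      positivity)
    (kronecker_J_mem_doublyStochastic ht hs.doublyStochastic)
  simp only [Fintype.card_prod, Fintype.card_fin] at h
  have hN : 0 < n * t := Nat.mul_pos hn ht
  have hN' : (0 : ℝ) < ((n * t : ℕ) : ℝ) := by exact_mod_cast hN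
  have hc : 0 ≤ ((n * t : ℕ) : ℝ) ^ (n * t) / ((n * t)! : ℝ) := by positivity
  refine le_trans (le_of_eq ?_) (mul_le_mul_of_nonneg_left h hc)
  field_simp

theorem p_le (ht : 0 < t) (X : simplex n) : p t X ≤ (8 * (t : ℝ)) ^ ((n : ℝ) / 2) := by
  have hs := isScaling_scaling X.1 X.2.1
  obtain ⟨-, -, hc⟩ := mem_doublyStochastic_iff_sum.1 hs.doublyStochastic
  have ht' : (0 : ℝ) < t := by exact_mod_cast ht
  have h1 := permanent_kronecker_J_le_of_col_sum (t := t) (fun i j => (hs.pos i j).le) hc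
  have h2 : ((n * t : ℕ) : ℝ) ^ (n * t) / ((n * t)! : ℝ) ≤ Real.exp 1 ^ (n * t) := by
    rw [← Real.exp_nat_mul, mul_one]
    exact Real.pow_div_factorial_le_exp _ (Nat.cast_nonneg _) _
  have h3 := pow_le_pow_left₀ (by positivity) (Nat.factorial_le_sqrt_mul_div_exp_pow ht) n
  calc p t X ≤ Real.exp 1 ^ (n * t) *
        ((√(8 * t) * (t / Real.exp 1) ^ t) ^ n / (t : ℝ) ^ (n * t)) := by
        unfold p
        refine mul_le_mul h2 (h1.trans ?_)
          (permanent_kronecker_J_nonneg fun i j => (hs.pos i j).le) (by positivity)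
        exact div_le_div_of_nonneg_right h3 (by positivity)
    _ = √(8 * t) ^ n := by
        rw [mul_pow, ← pow_mul, mul_comm t n, div_pow]
        field_simp
    _ = _ := by
        rw [Real.sqrt_eq_rpow, ← Real.rpow_natCast, ← Real.rpow_mul (by positivity)]
        congr 1
        ring

theorem f_nonneg (X : simplex n) : 0 ≤ f t X :=
  mul_nonneg (by positivity) (permanent_kronecker_J_nonneg fun i j => (X.2.1 i j).le)

theorem f_le (hn : 0 < n) (ht : 0 < t) (X : simplex n) :
    f t X ≤ ((n * t + n ^ 2 - 1).choose (n ^ 2 - 1) : ℝ) := by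
  have ht' : (0 : ℝ) < t := by exact_mod_cast ht
  have hn2 : 0 < n ^ 2 := by positivity
  have h := permanent_kronecker_J_le_of_sum (t := t) (fun i j => (X.2.1 i j).le) X.2.2
  unfold f
  refine (mul_le_mul_of_nonneg_left h (by positivity)).trans_eq ?_
  rw [Nat.cast_choose ℝ (by omega), show n * t + n ^ 2 - 1 - (n ^ 2 - 1) = n * t by omega]
  field_simp

end MagicSquares

theorem corollary3p2 (n t : ℕ) (hn : 0 < n) (ht : 0 < t) :
    ((MagicSquares.magicSquares n t).ncard ≤ (n * t + n ^ 2 - 1).choose (n ^ 2 - 1) ∧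
      ((n * t + n : ℕ) : ℝ) ^ (-(2 * n : ℤ)) *
          ((n * t + n ^ 2 - 1).choose (n ^ 2 - 1) : ℝ) ≤
        ((MagicSquares.magicSquares n t).ncard : ℝ)) ∧
    (∀ X : MagicSquares.simplex n,
      1 ≤ MagicSquares.p t X ∧ MagicSquares.p t X ≤ (8 * (t : ℝ)) ^ ((n : ℝ) / 2)) ∧
    (∀ X : MagicSquares.simplex n,
      0 ≤ MagicSquares.f t X ∧
        MagicSquares.f t X ≤ ((n * t + n ^ 2 - 1).choose (n ^ 2 - 1) : ℝ)) := by
  refine ⟨⟨ContingencyTable.ncard_magicSquares_le t hn, ?_⟩,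
    fun X => ⟨MagicSquares.one_le_p hn ht X, MagicSquares.p_le ht X⟩,
    fun X => ⟨MagicSquares.f_nonneg X, MagicSquares.f_le hn ht X⟩⟩
  have hpos : (0 : ℝ) < ((n * t + n : ℕ) : ℝ) := by
    exact_mod_cast Nat.add_pos_right (n * t) hn
  rw [zpow_neg, inv_mul_le_iff₀ (by positivity)]
  have h := ContingencyTable.choose_le_pow_mul_ncard_magicSquares t hn
  have h2 : ((n * t + n : ℕ) : ℝ) ^ (2 * n : ℤ) = ((n * t + n : ℕ) : ℝ) ^ (2 * n) := by
    rw [← zpow_natCast]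
    push_cast
    rfl
  rw [h2]
  exact_mod_cast h
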